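/- For $r \ge 1$ and a (possibly infinite) family $\mathcal F$ of finite $r$-uniform hypergraphs ($r$-graphs), let $\mathrm{ex}(n,\mathcal F)$ be the maximum number of edges of an $r$-graph on $n$ vertices that contains no member of $\mathcal F$ as a (not necessarily induced) subgraph, with $\mathrm{ex}(n,\mathcal F)=0$ if there is no such $r$-graph, and let $\pi(\mathcal F)=\lim_{n\to\infty}\mathrm{ex}(n,\mathcal F)/\binom{n}{r}$ be the Turán density of $\mathcal F$. Let $\Pi_\infty^{(r)}$ be the set of all Turán densities of families of $r$-graphs for $r\ge 1$, put $\Pi_\infty^{(0)}=\{1\}$, and let $$\Pi_\infty=\{(\alpha,r) : r\ge 0,\ \alpha\in\Pi_\infty^{(r)}\}\subseteq \mathbb R\times\mathbb N .$$ Define a binary operation on $\mathbb R\times\mathbb N$ by $$(\alpha,r)*(\beta,s)=\left(\alpha\beta\binom{r+s}{r}\frac{r^r s^s}{(r+s)^{r+s}},\ r+s\right),\qquad 0^0=1 .$$ Theorem. $\Pi_\infty$ is closed under $*$, and $(\Pi_\infty,*)$ is a commutative monoid with unit $(1,0)$. Every element of nonzero density is cancellable in it: if $a=(\alpha,r)$,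 $b$, $c$ are in $\Pi_\infty$, $\alpha\neq 0$ and $a*b=a*c$, then $b=c$. In particular, the elements $(\alpha,r)\in\Pi_\infty$ with $\alpha\ne 0$ form a commutative cancellative monoid under $*$. -/

import Mathlib

open Filter Topology

/-- A (simple) `r`-graph with vertex set (all of) `V`: every edge is an `r`-element set of
vertices.  Graphs without edges and the graph without vertices are allowed. -/
@[ext]
structure UniformHypergraph (r : ℕ) (V : Type*) where
  /-- The set of edges. -/
  edges : Finset (Finset V)
  /-- Every edge has exactly `r` vertices. -/
  card_eq : ∀ e ∈ edges, e.card = r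

namespace UniformHypergraph

variable {r : ℕ} {V W : Type*}

/-- `F.IsSubgraphOf G` means that there is an embedding of `F` into `G`: an injective map between
the vertex sets that maps edges to edges. -/
def IsSubgraphOf (F : UniformHypergraph r V) (G : UniformHypergraph r W) : Prop :=
  ∃ f : V ↪ W, ∀ e ∈ F.edges, e.map f ∈ G.edges

end UniformHypergraph

/-- A (possibly infinite, possibly empty) family of finite `r`-graphs.  Since only embeddings
matter, each member is represented by an isomorphic copy on `Fin k`, `k` its number of vertices. -/
abbrev HypergraphFamily (r : ℕ) : Type :=
  Set (Σ k : ℕ, UniformHypergraph r (Fin k))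

/-- `G` is `𝓕`-free if no subgraph of `G` belongs to `𝓕`. -/
def HypergraphFamily.Free {r : ℕ} {V : Type*} (𝓕 : HypergraphFamily r)
    (G : UniformHypergraph r V) : Prop :=
  ∀ F ∈ 𝓕, ¬ F.2.IsSubgraphOf G

/-- The Turán function `ex(n, 𝓕)`: the maximum number of edges of an `𝓕`-free `r`-graph on `n`
vertices.  The set below is finite, so this supremum in `ℕ` is a maximum when the set is nonempty,
and it is `0` if there is no `𝓕`-free `r`-graph on `n` vertices. -/
noncomputable def turanNumber {r : ℕ} (n : ℕ) (𝓕 : HypergraphFamily r) : ℕ :=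
  sSup {m : ℕ | ∃ G : UniformHypergraph r (Fin n), 𝓕.Free G ∧ G.edges.card = m}

/-- `α` is the Turán density of `𝓕`: the limit of `ex(n, 𝓕) / (n choose r)` as `n → ∞`
exists and equals `α`. -/
def HasTuranDensity {r : ℕ} (𝓕 : HypergraphFamily r) (α : ℝ) : Prop :=
  Tendsto (fun n : ℕ => (turanNumber n 𝓕 : ℝ) / (n.choose r : ℝ)) atTop (𝓝 α)

/-- The set of all Turán densities of families of `r`-graphs for `r ≥ 1`;
for `r = 0` it is `{1}` by convention. -/
def turanDensities (r : ℕ) : Set ℝ :=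
  if r = 0 then {1} else {α : ℝ | ∃ 𝓕 : HypergraphFamily r, HasTuranDensity 𝓕 α}

/-- The global set of Turán densities: all pairs `(α, r)` with `r ≥ 0` and `α` a Turán density of a
family of `r`-graphs. -/
def globalTuranDensities : Set (ℝ × ℕ) :=
  {p : ℝ × ℕ | p.1 ∈ turanDensities p.2}

/-- The operation `(α, r) * (β, s) = (αβ · C(r+s, r) · r^r s^s / (r+s)^(r+s), r + s)` on `ℝ × ℕ`,
with `0^0 = 1`. -/
noncomputable def turanMul (p q : ℝ × ℕ) : ℝ × ℕ :=
  (p.1 * q.1 * ((p.2 + q.2).choose p.2 : ℝ) *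
      (((p.2 : ℝ) ^ p.2 * (q.2 : ℝ) ^ q.2) / ((p.2 : ℝ) + (q.2 : ℝ)) ^ (p.2 + q.2)),
    p.2 + q.2)

/-!
Write `w r = r ^ r / r!`. The operation multiplies densities and corrects by the factor
`w r * w s / w (r + s)`, so `(α, r) ↦ (α * w r, r)` turns it into the coordinatewise operation
`(x, r), (y, s) ↦ (x * y, r + s)`. Associativity, commutativity and cancellation of elements with
nonzero density follow at once, and the point is closure.

Let `𝓕` be a family of `r`-graphs and `𝓖` a family of `s`-graphs, `r, s ≥ 1`. The *join* of an
`r`-graph and an `s`-graph lives on the disjoint union of the vertex sets, and its edges are the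
unions of an edge of the one and an edge of the other. Let `joinFamily 𝓕 𝓖` consist of all
`(r + s)`-graphs that do not embed into the join of an `𝓕`-free and a `𝓖`-free graph. The subgraphs
of such joins form a monotone class, so they are precisely the `joinFamily 𝓕 𝓖`-free graphs, and
therefore
`ex (n, joinFamily 𝓕 𝓖) = max_{a + b = n} ex (a, 𝓕) * ex (b, 𝓖)`
(`turanNumber_mul_le_turanNumber_joinFamily`, `exists_turanNumber_joinFamily_le`).

Asymptotically `ex (a, 𝓕)` is `α a ^ r / r!` and `ex (b, 𝓖)` is `β b ^ s / s!`. By the weighted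
inequality of arithmetic and geometric means, `a ^ r * b ^ s` with `a + b = n` is at most
`r ^ r * s ^ s / (r + s) ^ (r + s) * n ^ (r + s)`, and `a ≈ n r / (r + s)` attains this bound
asymptotically. The density of `joinFamily 𝓕 𝓖` is thus the density prescribed by the operation
(`tendsto_div_pow_of_max_mul`, `HasTuranDensity.joinFamily`).
-/

/-! ### Joins of uniform hypergraphs -/

namespace UniformHypergraph

variable {r s : ℕ} {U V W : Type*}

theorem IsSubgraphOf.refl (F : UniformHypergraph r V) : F.IsSubgraphOf F :=
  ⟨.refl V, fun e he => by simpa using he⟩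

theorem IsSubgraphOf.trans {F : UniformHypergraph r U} {G : UniformHypergraph r V}
    {H : UniformHypergraph r W} (h₁ : F.IsSubgraphOf G) (h₂ : G.IsSubgraphOf H) :
    F.IsSubgraphOf H := by
  obtain ⟨f, hf⟩ := h₁
  obtain ⟨g, hg⟩ := h₂
  exact ⟨f.trans g, fun e he => by rw [← Finset.map_map]; exact hg _ (hf e he)⟩

open Classical in
/-- The `r`-graph on `V` whose edges are the sets that `f` maps onto edges of `G`: up to the
identification of `V` with its image, the subgraph of `G` induced on the range of `f`. -/
noncomputable def comap [Fintype V] (f : V ↪ W) (G : UniformHypergraph r W) :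
    UniformHypergraph r V where
  edges := Finset.univ.filter fun e => e.map f ∈ G.edges
  card_eq e he := by
    have := G.card_eq _ (Finset.mem_filter.1 he).2
    rwa [Finset.card_map] at this

@[simp]
theorem mem_edges_comap [Fintype V] {f : V ↪ W} {G : UniformHypergraph r W} {e : Finset V} :
    e ∈ (G.comap f).edges ↔ e.map f ∈ G.edges := by
  simp [comap]

theorem comap_isSubgraphOf [Fintype V] (f : V ↪ W) (G : UniformHypergraph r W) :
    (G.comap f).IsSubgraphOf G :=
  ⟨f, fun _ he => mem_edges_comap.1 he⟩

theorem card_edges_le_card_edges_comap_equiv [Fintype V] (f : V ≃ W)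
    (G : UniformHypergraph r W) :
    G.edges.card ≤ (G.comap f.toEmbedding).edges.card := by
  refine Finset.card_le_card_of_injOn (fun e => e.map f.symm.toEmbedding) (fun e he => ?_)
    (Finset.map_injective _).injOn
  have h : (e.map f.symm.toEmbedding).map f.toEmbedding = e := by
    ext x
    simp
  simp only [Finset.mem_coe, mem_edges_comap, h]
  exact he

/-- The join of an `r`-graph on `V` and an `s`-graph on `W`: the `(r + s)`-graph on the disjoint
union of `V` and `W` whose edges are the unions of an edge of `G` and an edge of `H`. -/
def join (G : UniformHypergraph r V) (H : UniformHypergraph s W) :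
    UniformHypergraph (r + s) (V ⊕ W) where
  edges := (G.edges ×ˢ H.edges).map Finset.sumEquiv.symm.toEquiv.toEmbedding
  card_eq e he := by
    obtain ⟨⟨a, b⟩, hab, rfl⟩ := Finset.mem_map.1 he
    obtain ⟨ha, hb⟩ := Finset.mem_product.1 hab
    exact (Finset.card_disjSum a b).trans (by rw [G.card_eq a ha, H.card_eq b hb])

theorem mem_edges_join {G : UniformHypergraph r V} {H : UniformHypergraph s W}
    {e : Finset (V ⊕ W)} :
    e ∈ (G.join H).edges ↔ e.toLeft ∈ G.edges ∧ e.toRight ∈ H.edges := by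
  constructor
  · intro he
    obtain ⟨⟨a, b⟩, hab, rfl⟩ := Finset.mem_map.1 he
    simpa using hab
  · rintro ⟨h₁, h₂⟩
    exact Finset.mem_map.2 ⟨(e.toLeft, e.toRight), Finset.mem_product.2 ⟨h₁, h₂⟩,
      Finset.toLeft_disjSum_toRight⟩

theorem card_edges_join (G : UniformHypergraph r V) (H : UniformHypergraph s W) :
    (G.join H).edges.card = G.edges.card * H.edges.card := by
  rw [join, Finset.card_map, Finset.card_product]

end UniformHypergraph

/-! ### Turán numbers of joins -/

open UniformHypergraph

section TuranNumber

variable {r s : ℕ} {V W : Type*}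

theorem HypergraphFamily.Free.of_isSubgraphOf {𝓕 : HypergraphFamily r}
    {G : UniformHypergraph r V} {H : UniformHypergraph r W} (hH : 𝓕.Free H)
    (h : G.IsSubgraphOf H) : 𝓕.Free G :=
  fun F hF hFG => hH F hF (hFG.trans h)

theorem bddAbove_card_edges_free (n : ℕ) (𝓕 : HypergraphFamily r) :
    BddAbove {m : ℕ | ∃ G : UniformHypergraph r (Fin n), 𝓕.Free G ∧ G.edges.card = m} := by
  refine ⟨Fintype.card (Finset (Fin n)), ?_⟩
  rintro m ⟨G, -, rfl⟩
  exact Finset.card_le_univ _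

theorem HypergraphFamily.Free.card_edges_le_turanNumber {n : ℕ} {𝓕 : HypergraphFamily r}
    {G : UniformHypergraph r (Fin n)} (hG : 𝓕.Free G) : G.edges.card ≤ turanNumber n 𝓕 :=
  le_csSup (bddAbove_card_edges_free n 𝓕) ⟨G, hG, rfl⟩

theorem exists_free_card_edges_eq_turanNumber {n : ℕ} {𝓕 : HypergraphFamily r}
    (h : turanNumber n 𝓕 ≠ 0) :
    ∃ G : UniformHypergraph r (Fin n), 𝓕.Free G ∧ G.edges.card = turanNumber n 𝓕 := by
  refine Nat.sSup_mem (Set.nonempty_iff_ne_empty.2 fun h₀ => h ?_) (bddAbove_card_edges_free n 𝓕)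
  rw [turanNumber, h₀, csSup_empty, Nat.bot_eq_zero]

theorem HypergraphFamily.Free.card_edges_within_le_turanNumber [DecidableEq V]
    {𝓕 : HypergraphFamily r} {G : UniformHypergraph r V} (hG : 𝓕.Free G) (S : Finset V) :
    (G.edges.filter (· ⊆ S)).card ≤ turanNumber S.card 𝓕 := by
  let f : Fin S.card ↪ V := S.equivFin.symm.toEmbedding.trans (.subtype _)
  have hf : S ⊆ Finset.univ.map f := fun x hx =>
    Finset.mem_map.2 ⟨S.equivFin ⟨x, hx⟩, Finset.mem_univ _, by simp [f]⟩
  refine le_trans ?_ (hG.of_isSubgraphOf (comap_isSubgraphOf f G)).card_edges_le_turanNumber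
  rw [← Finset.card_map (Finset.mapEmbedding f).toEmbedding]
  refine Finset.card_le_card fun e he => ?_
  obtain ⟨heG, heS⟩ := Finset.mem_filter.1 he
  obtain ⟨u, -, rfl⟩ := Finset.subset_map_iff.1 (heS.trans hf)
  exact Finset.mem_map.2 ⟨u, mem_edges_comap.2 heG, rfl⟩

/-- The family of all `(r + s)`-graphs that do not embed into the join of an `𝓕`-free `r`-graph and
a `𝓖`-free `s`-graph. -/
def joinFamily (𝓕 : HypergraphFamily r) (𝓖 : HypergraphFamily s) : HypergraphFamily (r + s) :=
  {F | ∀ (a b : ℕ) (G : UniformHypergraph r (Fin a)) (H : UniformHypergraph s (Fin b)),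
    𝓕.Free G → 𝓖.Free H → ¬ F.2.IsSubgraphOf (G.join H)}

theorem joinFamily_free_iff {𝓕 : HypergraphFamily r} {𝓖 : HypergraphFamily s} {n : ℕ}
    {F : UniformHypergraph (r + s) (Fin n)} :
    (joinFamily 𝓕 𝓖).Free F ↔
      ∃ (a b : ℕ) (G : UniformHypergraph r (Fin a)) (H : UniformHypergraph s (Fin b)),
        𝓕.Free G ∧ 𝓖.Free H ∧ F.IsSubgraphOf (G.join H) := by
  constructor
  · intro h
    by_contra! hF
    exact h ⟨n, F⟩ hF (.refl F)
  · rintro ⟨a, b, G, H, hG, hH, hF⟩ F' hF' hsub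
    exact hF' a b G H hG hH (hsub.trans hF)

theorem turanNumber_mul_le_turanNumber_joinFamily (𝓕 : HypergraphFamily r)
    (𝓖 : HypergraphFamily s) (a b : ℕ) :
    turanNumber a 𝓕 * turanNumber b 𝓖 ≤ turanNumber (a + b) (joinFamily 𝓕 𝓖) := by
  -- A Turán number that is `0` need not be attained: there may be no free graph at all.
  by_cases ha : turanNumber a 𝓕 = 0
  · simp [ha]
  by_cases hb : turanNumber b 𝓖 = 0
  · simp [hb]
  obtain ⟨G, hG, hGc⟩ := exists_free_card_edges_eq_turanNumber ha
  obtain ⟨H, hH, hHc⟩ := exists_free_card_edges_eq_turanNumber hb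
  rw [← hGc, ← hHc, ← card_edges_join]
  refine (card_edges_le_card_edges_comap_equiv finSumFinEquiv.symm (G.join H)).trans ?_
  exact (joinFamily_free_iff.2
    ⟨a, b, G, H, hG, hH, comap_isSubgraphOf _ _⟩).card_edges_le_turanNumber

theorem exists_turanNumber_joinFamily_le (𝓕 : HypergraphFamily r) (𝓖 : HypergraphFamily s)
    (n : ℕ) :
    ∃ a b : ℕ, a + b = n ∧
      turanNumber n (joinFamily 𝓕 𝓖) ≤ turanNumber a 𝓕 * turanNumber b 𝓖 := by
  by_cases hn : turanNumber n (joinFamily 𝓕 𝓖) = 0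
  · exact ⟨n, 0, rfl, by simp [hn]⟩
  obtain ⟨F, hF, hFc⟩ := exists_free_card_edges_eq_turanNumber hn
  obtain ⟨a, b, G, H, hG, hH, φ, hφ⟩ := joinFamily_free_iff.1 hF
  -- The images of the vertices of `F` on the two sides of the join give the partition of `n`.
  let S : Finset (Fin a ⊕ Fin b) := Finset.univ.map φ
  have hS : S.toLeft.card + S.toRight.card = n := by
    rw [Finset.card_toLeft_add_card_toRight, Finset.card_map, Finset.card_fin]
  refine ⟨_, _, hS, ?_⟩
  rw [← hFc]
  refine le_trans ?_ (Nat.mul_le_mul (hG.card_edges_within_le_turanNumber S.toLeft)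
    (hH.card_edges_within_le_turanNumber S.toRight))
  rw [← Finset.card_product]
  refine Finset.card_le_card_of_injOn (fun e => Finset.sumEquiv (e.map φ)) (fun e he => ?_)
    ((Finset.sumEquiv.injective.comp (Finset.map_injective φ)).injOn)
  obtain ⟨h₁, h₂⟩ := mem_edges_join.1 (hφ e he)
  have hsub : e.map φ ⊆ S := Finset.map_subset_map.2 (Finset.subset_univ e)
  exact Finset.mem_product.2 ⟨Finset.mem_filter.2 ⟨h₁, Finset.toLeft_subset_toLeft hsub⟩,
    Finset.mem_filter.2 ⟨h₂, Finset.toRight_subset_toRight hsub⟩⟩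

end TuranNumber

/-! ### Asymptotics of the maximal product -/

theorem tendsto_choose_div_pow (r : ℕ) :
    Tendsto (fun n : ℕ => (n.choose r : ℝ) / (n : ℝ) ^ r) atTop (𝓝 (1 / (r.factorial : ℝ))) := by
  have h : Tendsto (fun n : ℕ => (n : ℝ) * (n : ℝ)⁻¹) atTop (𝓝 1) := by
    refine tendsto_const_nhds.congr' ?_
    filter_upwards [eventually_ne_atTop 0] with n hn
    rw [mul_inv_cancel₀ (Nat.cast_ne_zero.2 hn)]
  simpa [div_eq_mul_inv] using ProbabilityTheory.tendsto_choose_mul_pow_atTop r h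

theorem tendsto_div_choose_iff {f : ℕ → ℝ} {r : ℕ} {α : ℝ} :
    Tendsto (fun n : ℕ => f n / (n.choose r : ℝ)) atTop (𝓝 α) ↔
      Tendsto (fun n : ℕ => f n / (n : ℝ) ^ r) atTop (𝓝 (α / r.factorial)) := by
  have hr : (r.factorial : ℝ) ≠ 0 := Nat.cast_ne_zero.2 r.factorial_ne_zero
  have hc := tendsto_choose_div_pow r
  constructor
  · intro h
    rw [div_eq_mul_one_div]
    refine (h.mul hc).congr' ?_
    filter_upwards [eventually_ge_atTop r] with n hn
    have : (n.choose r : ℝ) ≠ 0 := Nat.cast_ne_zero.2 (Nat.choose_pos hn).ne'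
    field_simp
  · intro h
    have := h.div hc (one_div_ne_zero hr)
    rw [div_div_div_cancel_right₀ hr, div_one] at this
    refine this.congr' ?_
    filter_upwards [eventually_ne_atTop 0] with n hn
    exact div_div_div_cancel_right₀ (pow_ne_zero r (Nat.cast_ne_zero.2 hn)) _ _

/-- The inequality of arithmetic and geometric means for `r` copies of `x / r` and `s` copies of
`y / s`. -/
theorem pow_mul_pow_le {r s : ℕ} (hr : r ≠ 0) (hs : s ≠ 0) {x y : ℝ} (hx : 0 ≤ x) (hy : 0 ≤ y) :
    x ^ r * y ^ s ≤
      ((r : ℝ) ^ r * (s : ℝ) ^ s) / ((r : ℝ) + s) ^ (r + s) * (x + y) ^ (r + s) := by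
  have hr' : (0 : ℝ) < r := by positivity
  have hs' : (0 : ℝ) < s := by positivity
  have h := Real.geom_mean_le_arith_mean2_weighted (w₁ := r / (r + s)) (w₂ := s / (r + s))
    (p₁ := x / r) (p₂ := y / s) (by positivity) (by positivity) (by positivity) (by positivity)
    (by field_simp)
  have h' := pow_le_pow_left₀ (by positivity) h (r + s)
  have e₁ : ((x / r) ^ ((r : ℝ) / (r + s))) ^ (r + s) = (x / r) ^ r := by
    rw [← Real.rpow_natCast, ← Real.rpow_mul (by positivity), ← Real.rpow_natCast]
    congr 1
    push_cast
    field_simp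
  have e₂ : ((y / s) ^ ((s : ℝ) / (r + s))) ^ (r + s) = (y / s) ^ s := by
    rw [← Real.rpow_natCast, ← Real.rpow_mul (by positivity), ← Real.rpow_natCast]
    congr 1
    push_cast
    field_simp
  have e₃ : (r : ℝ) / (r + s) * (x / r) + s / (r + s) * (y / s) = (x + y) / (r + s) := by
    field_simp
  rw [mul_pow, e₁, e₂, e₃, div_pow, div_pow, div_pow] at h'
  calc x ^ r * y ^ s =
      (r : ℝ) ^ r * (s : ℝ) ^ s * (x ^ r / (r : ℝ) ^ r * (y ^ s / (s : ℝ) ^ s)) := by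
        field_simp
    _ ≤ (r : ℝ) ^ r * (s : ℝ) ^ s * ((x + y) ^ (r + s) / ((r : ℝ) + s) ^ (r + s)) := by
        gcongr
    _ = _ := by ring

/-- A bound for every `n`, at the price of an additive constant that accounts for small `n`. -/
theorem exists_le_mul_pow_add {f : ℕ → ℝ} (hf : ∀ n, 0 ≤ f n) {r : ℕ} {α c : ℝ}
    (h : Tendsto (fun n : ℕ => f n / (n : ℝ) ^ r) atTop (𝓝 α)) (hα : 0 ≤ α) (hc : α < c) :
    ∃ K : ℝ, 0 ≤ K ∧ ∀ n : ℕ, f n ≤ c * (n : ℝ) ^ r + K := by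
  have hc₀ : 0 < c := hα.trans_lt hc
  obtain ⟨N, hN⟩ := eventually_atTop.1
    ((h.eventually_lt_const hc).and (eventually_gt_atTop 0))
  have hsum : 0 ≤ ∑ i ∈ Finset.range N, f i := Finset.sum_nonneg fun i _ => hf i
  refine ⟨_, hsum, fun n => ?_⟩
  rcases lt_or_ge n N with hn | hn
  · have h₁ : f n ≤ ∑ i ∈ Finset.range N, f i :=
      Finset.single_le_sum (fun i _ => hf i) (Finset.mem_range.2 hn)
    have h₂ : 0 ≤ c * (n : ℝ) ^ r := by positivity
    linarith
  · obtain ⟨h₁, h₂⟩ := hN n hn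
    have := (div_lt_iff₀ (by positivity)).1 h₁
    linarith

theorem tendsto_natCast_pow_div_pow {m k : ℕ} (h : m < k) :
    Tendsto (fun n : ℕ => (n : ℝ) ^ m / (n : ℝ) ^ k) atTop (𝓝 0) :=
  (tendsto_pow_div_pow_atTop_zero h).comp tendsto_natCast_atTop_atTop

/-- If `h n` is the maximum of `f a * g b` over `a + b = n`, and `f` and `g` grow like `α n ^ r` and
`β n ^ s`, then `h` grows like the maximum of `α a ^ r * β b ^ s` over real `a + b = n`. -/
theorem tendsto_div_pow_of_max_mul {f g h : ℕ → ℝ} (hf : ∀ n, 0 ≤ f n) (hg : ∀ n, 0 ≤ g n)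
    {r s : ℕ} (hr : r ≠ 0) (hs : s ≠ 0) {α β : ℝ}
    (hfα : Tendsto (fun n : ℕ => f n / (n : ℝ) ^ r) atTop (𝓝 α))
    (hgβ : Tendsto (fun n : ℕ => g n / (n : ℝ) ^ s) atTop (𝓝 β))
    (hle : ∀ a b, f a * g b ≤ h (a + b)) (hge : ∀ n, ∃ a b, a + b = n ∧ h n ≤ f a * g b) :
    Tendsto (fun n : ℕ => h n / (n : ℝ) ^ (r + s)) atTop
      (𝓝 (α * β * (((r : ℝ) ^ r * (s : ℝ) ^ s) / ((r : ℝ) + s) ^ (r + s)))) := by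
  have hr' : (0 : ℝ) < r := by positivity
  have hs' : (0 : ℝ) < s := by positivity
  set M : ℝ := ((r : ℝ) ^ r * (s : ℝ) ^ s) / ((r : ℝ) + s) ^ (r + s) with hM
  have hM₀ : 0 ≤ M := by positivity
  have hα : 0 ≤ α := ge_of_tendsto' hfα fun n => div_nonneg (hf n) (by positivity)
  have hβ : 0 ≤ β := ge_of_tendsto' hgβ fun n => div_nonneg (hg n) (by positivity)
  refine tendsto_order.2 ⟨fun t ht => ?_, fun t ht => ?_⟩
  · -- The lower bound: split `n` in the ratio `r : s`.
    let p : ℝ := r / (r + s)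
    have hp : 0 < p := by positivity
    have hps : 1 - p = s / (r + s) := by simp only [p]; field_simp; ring
    have hp₁ : 0 < 1 - p := by rw [hps]; positivity
    let a : ℕ → ℕ := fun n => ⌊p * n⌋₊
    have ha_le : ∀ n, a n ≤ n := fun n => by
      refine Nat.floor_le_of_le ?_
      have : (0 : ℝ) ≤ n := n.cast_nonneg
      nlinarith
    have ha : Tendsto (fun n : ℕ => (a n : ℝ) / n) atTop (𝓝 p) :=
      (tendsto_nat_floor_mul_div_atTop hp.le).comp tendsto_natCast_atTop_atTop
    have hb : Tendsto (fun n : ℕ => ((n - a n : ℕ) : ℝ) / n) atTop (𝓝 (1 - p)) := by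
      refine (ha.const_sub 1).congr' ?_
      filter_upwards [eventually_ne_atTop 0] with n hn
      have : (n : ℝ) ≠ 0 := Nat.cast_ne_zero.2 hn
      rw [Nat.cast_sub (ha_le n)]
      field_simp
    have hinf : ∀ {q : ℝ} {u : ℕ → ℕ}, 0 < q →
        Tendsto (fun n : ℕ => (u n : ℝ) / n) atTop (𝓝 q) → Tendsto u atTop atTop := by
      intro q u hq hu
      refine tendsto_natCast_atTop_iff (R := ℝ).1 ?_
      refine (hu.pos_mul_atTop hq tendsto_natCast_atTop_atTop).congr' ?_
      filter_upwards [eventually_ne_atTop 0] with n hn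
      exact div_mul_cancel₀ _ (Nat.cast_ne_zero.2 hn)
    have ha' := hinf hp ha
    have hb' := hinf hp₁ hb
    have hlim := ((hfα.comp ha').mul (ha.pow r)).mul ((hgβ.comp hb').mul (hb.pow s))
    have hval : α * p ^ r * (β * (1 - p) ^ s) = α * β * M := by
      rw [hps, hM]
      simp only [p]
      rw [div_pow, div_pow, pow_add]
      field_simp
    rw [hval] at hlim
    filter_upwards [hlim.eventually_const_lt ht, eventually_gt_atTop 0,
      ha'.eventually_gt_atTop 0, hb'.eventually_gt_atTop 0] with n hn hn₀ han hbn
    refine hn.trans_le ?_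
    have hn₀' : (0 : ℝ) < n := by positivity
    have han' : (0 : ℝ) < a n := by positivity
    have hbn' : (0 : ℝ) < (n - a n : ℕ) := by positivity
    have key := hle (a n) (n - a n)
    rw [Nat.add_sub_cancel' (ha_le n)] at key
    rw [le_div_iff₀ (by positivity)]
    refine le_trans (le_of_eq ?_) key
    simp only [Function.comp_apply]
    rw [div_pow, div_pow, pow_add]
    field_simp
  · -- The upper bound: replace `α` and `β` by slightly larger constants.
    have hε : Tendsto (fun ε : ℝ => (α + ε) * (β + ε) * M) (𝓝[>] 0) (𝓝 (α * β * M)) := by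
      have : Continuous fun ε : ℝ => (α + ε) * (β + ε) * M := by fun_prop
      simpa using (this.tendsto 0).mono_left nhdsWithin_le_nhds
    obtain ⟨ε, hεt, hε₀⟩ := ((hε.eventually_lt_const ht).and self_mem_nhdsWithin).exists
    have hε₀ : 0 < ε := hε₀
    obtain ⟨K, hK, hfK⟩ := exists_le_mul_pow_add hf hfα hα (show α < α + ε by linarith)
    obtain ⟨L, hL, hgL⟩ := exists_le_mul_pow_add hg hgβ hβ (show β < β + ε by linarith)
    set c := α + ε
    set d := β + ε
    have hc : 0 < c := by positivity
    have hd : 0 < d := by positivity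
    have hbound : ∀ n : ℕ, h n ≤ c * d * M * (n : ℝ) ^ (r + s) + c * L * (n : ℝ) ^ r
        + d * K * (n : ℝ) ^ s + K * L * (n : ℝ) ^ 0 := by
      intro n
      obtain ⟨a, b, rfl, hab⟩ := hge n
      have h₁ := mul_le_mul (hfK a) (hgL b) (hg b) (by positivity)
      have h₂ := pow_mul_pow_le hr hs (Nat.cast_nonneg (α := ℝ) a) (Nat.cast_nonneg b)
      have h₃ : (a : ℝ) ^ r ≤ ((a + b : ℕ) : ℝ) ^ r := by gcongr; simp
      have h₄ : (b : ℝ) ^ s ≤ ((a + b : ℕ) : ℝ) ^ s := by gcongr; simp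
      calc h (a + b) ≤ (c * (a : ℝ) ^ r + K) * (d * (b : ℝ) ^ s + L) := hab.trans h₁
        _ = c * d * ((a : ℝ) ^ r * (b : ℝ) ^ s) + c * L * (a : ℝ) ^ r
            + d * K * (b : ℝ) ^ s + K * L := by ring
        _ ≤ c * d * (M * ((a + b : ℕ) : ℝ) ^ (r + s)) + c * L * ((a + b : ℕ) : ℝ) ^ r
            + d * K * ((a + b : ℕ) : ℝ) ^ s + K * L := by
          rw [← hM] at h₂
          rw [← Nat.cast_add] at h₂
          gcongr
        _ = _ := by ring
    have hlim : Tendsto (fun n : ℕ => c * d * M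
        + c * L * ((n : ℝ) ^ r / (n : ℝ) ^ (r + s))
        + d * K * ((n : ℝ) ^ s / (n : ℝ) ^ (r + s))
        + K * L * ((n : ℝ) ^ 0 / (n : ℝ) ^ (r + s))) atTop (𝓝 (c * d * M)) := by
      simpa only [mul_zero, add_zero] using
        (((tendsto_const_nhds (x := c * d * M)).add
          ((tendsto_natCast_pow_div_pow (m := r) (k := r + s) (by omega)).const_mul (c * L))).add
          ((tendsto_natCast_pow_div_pow (m := s) (k := r + s) (by omega)).const_mul (d * K))).add
          ((tendsto_natCast_pow_div_pow (m := 0) (k := r + s) (by omega)).const_mul (K * L))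
    filter_upwards [hlim.eventually_lt_const hεt, eventually_gt_atTop 0] with n hn hn₀
    refine lt_of_le_of_lt ?_ hn
    have hn₀' : (0 : ℝ) < n := by positivity
    rw [div_le_iff₀ (by positivity)]
    refine (hbound n).trans (le_of_eq ?_)
    field_simp

/-! ### The monoid of Turán densities -/

theorem HasTuranDensity.joinFamily {r s : ℕ} (hr : r ≠ 0) (hs : s ≠ 0) {𝓕 : HypergraphFamily r}
    {𝓖 : HypergraphFamily s} {α β : ℝ} (h𝓕 : HasTuranDensity 𝓕 α) (h𝓖 : HasTuranDensity 𝓖 β) :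
    HasTuranDensity (joinFamily 𝓕 𝓖) (turanMul (α, r) (β, s)).1 := by
  have h := tendsto_div_pow_of_max_mul (h := fun n => (turanNumber n (_root_.joinFamily 𝓕 𝓖) : ℝ))
    (fun n => Nat.cast_nonneg _) (fun n => Nat.cast_nonneg _) hr hs
    (tendsto_div_choose_iff.1 h𝓕) (tendsto_div_choose_iff.1 h𝓖)
    (fun a b => by exact_mod_cast turanNumber_mul_le_turanNumber_joinFamily 𝓕 𝓖 a b)
    (fun n => by
      obtain ⟨a, b, hab, hle⟩ := exists_turanNumber_joinFamily_le 𝓕 𝓖 n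
      exact ⟨a, b, hab, by exact_mod_cast hle⟩)
  refine tendsto_div_choose_iff.2 ?_
  convert h using 2
  have h₀ : ∀ k : ℕ, (k.factorial : ℝ) ≠ 0 := fun k => Nat.cast_ne_zero.2 k.factorial_ne_zero
  have := h₀ r
  have := h₀ s
  have := h₀ (r + s)
  simp only [turanMul]
  rw [Nat.cast_add_choose]
  field_simp

theorem turanMul_comm (p q : ℝ × ℕ) : turanMul p q = turanMul q p := by
  refine Prod.ext ?_ (add_comm _ _)
  simp only [turanMul]
  rw [Nat.choose_symm_add, add_comm p.2 q.2, add_comm (p.2 : ℝ) (q.2 : ℝ)]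
  ring

theorem one_zero_turanMul (p : ℝ × ℕ) : turanMul (1, 0) p = p := by
  have h : ((p.2 : ℝ) ^ p.2) ≠ 0 := by
    rcases eq_or_ne p.2 0 with h | h
    · simp [h]
    · positivity
  refine Prod.ext ?_ (zero_add _)
  simp [turanMul, h]

/-- The weight `r ^ r / r!`, with value `1` at `r = 0`, through which `turanMul` becomes
coordinatewise. -/
noncomputable def turanWeight (r : ℕ) : ℝ := (r : ℝ) ^ r / r.factorial

theorem turanWeight_pos (r : ℕ) : 0 < turanWeight r := by
  rcases eq_or_ne r 0 with h | h
  · simp [turanWeight, h]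
  · have : (0 : ℝ) < r := by positivity
    exact div_pos (by positivity) (by positivity)

theorem turanMul_fst_mul_turanWeight (p q : ℝ × ℕ) :
    (turanMul p q).1 * turanWeight (turanMul p q).2 =
      (p.1 * turanWeight p.2) * (q.1 * turanWeight q.2) := by
  have h₀ : ∀ k : ℕ, (k.factorial : ℝ) ≠ 0 := fun k => Nat.cast_ne_zero.2 k.factorial_ne_zero
  have hp := h₀ p.2
  have hq := h₀ q.2
  have hpq := h₀ (p.2 + q.2)
  have hpow : ((p.2 : ℝ) + (q.2 : ℝ)) ^ (p.2 + q.2) ≠ 0 := by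
    have := (turanWeight_pos (p.2 + q.2)).ne'
    rw [turanWeight, div_ne_zero_iff] at this
    exact_mod_cast this.1
  simp only [turanMul, turanWeight]
  rw [Nat.cast_add_choose, Nat.cast_add]
  field_simp

/-- A pair is determined by its second entry and its weighted first entry. -/
theorem ext_turanWeight {p q : ℝ × ℕ} (h₂ : p.2 = q.2)
    (h₁ : p.1 * turanWeight p.2 = q.1 * turanWeight q.2) : p = q := by
  rw [h₂] at h₁
  exact Prod.ext (mul_right_cancel₀ (turanWeight_pos q.2).ne' h₁) h₂

theorem turanMul_assoc (p q t : ℝ × ℕ) :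
    turanMul (turanMul p q) t = turanMul p (turanMul q t) := by
  refine ext_turanWeight (add_assoc _ _ _) ?_
  simp only [turanMul_fst_mul_turanWeight, mul_assoc]

theorem turanMul_left_cancel {p q t : ℝ × ℕ} (hp : p.1 ≠ 0)
    (h : turanMul p q = turanMul p t) : q = t := by
  refine ext_turanWeight (Nat.add_left_cancel (congrArg Prod.snd h)) ?_
  have h' := congrArg (fun z : ℝ × ℕ => z.1 * turanWeight z.2) h
  simp only [turanMul_fst_mul_turanWeight] at h'
  exact mul_left_cancel₀ (mul_ne_zero hp (turanWeight_pos _).ne') h'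

theorem turanMul_fst_ne_zero {p q : ℝ × ℕ} (hp : p.1 ≠ 0) (hq : q.1 ≠ 0) :
    (turanMul p q).1 ≠ 0 := by
  refine left_ne_zero_of_mul (b := turanWeight (turanMul p q).2) ?_
  rw [turanMul_fst_mul_turanWeight]
  exact mul_ne_zero (mul_ne_zero hp (turanWeight_pos _).ne')
    (mul_ne_zero hq (turanWeight_pos _).ne')

theorem one_zero_mem_globalTuranDensities : ((1 : ℝ), (0 : ℕ)) ∈ globalTuranDensities := by
  simp [globalTuranDensities, turanDensities]

theorem eq_one_zero_of_mem {p : ℝ × ℕ} (hp : p ∈ globalTuranDensities) (h : p.2 = 0) :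
    p = (1, 0) := by
  simp only [globalTuranDensities, turanDensities, Set.mem_ofPred_eq, h, if_true,
    Set.mem_singleton_iff] at hp
  exact Prod.ext hp h

theorem turanMul_mem_globalTuranDensities {p q : ℝ × ℕ} (hp : p ∈ globalTuranDensities)
    (hq : q ∈ globalTuranDensities) : turanMul p q ∈ globalTuranDensities := by
  by_cases hr : p.2 = 0
  · rwa [eq_one_zero_of_mem hp hr, one_zero_turanMul]
  by_cases hs : q.2 = 0
  · rwa [eq_one_zero_of_mem hq hs, turanMul_comm, one_zero_turanMul]
  simp only [globalTuranDensities, turanDensities, Set.mem_ofPred_eq, hr, hs, if_false] at hp hq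
  obtain ⟨𝓕, h𝓕⟩ := hp
  obtain ⟨𝓖, h𝓖⟩ := hq
  have hrs : (turanMul p q).2 ≠ 0 := fun h => hr (Nat.add_eq_zero_iff.1 h).1
  simp only [globalTuranDensities, turanDensities, Set.mem_ofPred_eq, hrs, if_false]
  exact ⟨joinFamily 𝓕 𝓖, h𝓕.joinFamily hr hs h𝓖⟩

/-- The set of all Turán densities as a commutative monoid under `turanMul`. -/
noncomputable abbrev globalTuranDensitiesCommMonoid : CommMonoid globalTuranDensities where
  mul a b := ⟨turanMul a b, turanMul_mem_globalTuranDensities a.2 b.2⟩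
  one := ⟨(1, 0), one_zero_mem_globalTuranDensities⟩
  mul_assoc a b c := Subtype.ext (turanMul_assoc a b c)
  mul_comm a b := Subtype.ext (turanMul_comm a b)
  one_mul a := Subtype.ext (one_zero_turanMul a)
  mul_one a := Subtype.ext ((turanMul_comm a (1, 0)).trans (one_zero_turanMul a))

theorem mainTheorem2 :
    ∃ _ : CommMonoid globalTuranDensities,
      (∀ a b : globalTuranDensities,
        ((a * b : globalTuranDensities) : ℝ × ℕ) = turanMul (a : ℝ × ℕ) (b : ℝ × ℕ)) ∧
      ((1 : globalTuranDensities) : ℝ × ℕ) = ((1 : ℝ), (0 : ℕ)) ∧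
      (∀ a b c : globalTuranDensities,
        (a : ℝ × ℕ).1 ≠ 0 → a * b = a * c → b = c) ∧
      ∃ S : Submonoid globalTuranDensities,
        (∀ a : globalTuranDensities, a ∈ S ↔ (a : ℝ × ℕ).1 ≠ 0) ∧ IsCancelMul S := by
  let _ := globalTuranDensitiesCommMonoid
  have hcancel : ∀ a b c : globalTuranDensities,
      (a : ℝ × ℕ).1 ≠ 0 → a * b = a * c → b = c := fun a b c ha h =>
    Subtype.ext (turanMul_left_cancel ha (congrArg Subtype.val h))
  let S : Submonoid globalTuranDensities :=
    { carrier := {a | (a : ℝ × ℕ).1 ≠ 0}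
      mul_mem' := fun ha hb => turanMul_fst_ne_zero ha hb
      one_mem' := one_ne_zero (α := ℝ) }
  have hS : IsLeftCancelMul S := ⟨fun a b c h =>
    Subtype.ext (hcancel a b c a.2 (congrArg Subtype.val h))⟩
  exact ⟨globalTuranDensitiesCommMonoid, fun _ _ => rfl, rfl, hcancel, S, fun _ => Iff.rfl,
    CommMagma.IsLeftCancelMul.toIsCancelMul S⟩
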